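/- Let $K$ be a field, $S=K[x_1,\ldots,x_n]$, and let $I\subseteq S$ be a monomial ideal with minimal set of monomial generators $G(I)$. For a nonempty subset $A\subseteq G(I)$, a monomial $u\in A$ is called a leaf of $A$ if either $A=\{u\}$, or there exists $v\in A$ with $v\neq u$ such that $\gcd(u,w)\mid\gcd(u,v)$ for all $w\in A$ with $w\neq u$. Suppose that $I$ is of forest type, that is, every nonempty subset of $G(I)$ has a leaf. Then $S/I$ is pretty clean: there exist $r\ge 0$, a chain of ideals $I=I_0\subseteq I_1\subseteq\cdots\subseteq I_r=S$ and monomial prime ideals $P_1,\ldots,P_r$ of $S$ such that $I_j/I_{j-1}\cong S/P_j$ as $S$-modules for all $j=1,\ldots,r$, and such that for all $i<j$, $P_i\subseteq P_j$ implies $P_i=P_j$. -/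

import Mathlib

open MvPolynomial

namespace ForestType

variable {σ : Type*} {K : Type*} [Field K]

/-- An ideal of `K[x_i : i ∈ σ]` is a monomial ideal if it is generated by monomials.
The monomial `∏ x_i ^ (a i)` is `monomial a 1`. -/
def IsMonomialIdeal (I : Ideal (MvPolynomial σ K)) : Prop :=
  ∃ A : Set (σ →₀ ℕ), I = Ideal.span ((fun a => (monomial a (1 : K))) '' A)

/-- `G(I)`: the exponent vectors of the monomials in `I` that are minimal with respect to
divisibility (`≤` on exponent vectors is divisibility of monomials).  For a monomial ideal these
are exactly the unique minimal monomial generators. -/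
def minGens (I : Ideal (MvPolynomial σ K)) : Set (σ →₀ ℕ) :=
  {a | Minimal (fun b => monomial b (1 : K) ∈ I) a}

/-- `u` is a leaf of the set of monomials `A` (given by exponent vectors, so that `⊓` is the gcd
and `≤` is divisibility): either `u` is the only element of `A`, or there is a branch `v ∈ A`,
`v ≠ u`, such that `gcd(u, w) ∣ gcd(u, v)` for all `w ∈ A`, `w ≠ u`. -/
def IsLeaf (A : Set (σ →₀ ℕ)) (u : σ →₀ ℕ) : Prop :=
  u ∈ A ∧ (A = {u} ∨ ∃ v ∈ A, v ≠ u ∧ ∀ w ∈ A, w ≠ u → u ⊓ w ≤ u ⊓ v)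

/-- A monomial ideal of forest type: every nonempty subset of `G(I)` has a leaf. -/
def IsForestType (I : Ideal (MvPolynomial σ K)) : Prop :=
  IsMonomialIdeal I ∧ ∀ A ⊆ minGens I, A.Nonempty → ∃ u, IsLeaf A u

/-- `S ⧸ I` is pretty clean: there is a chain of ideals `I = I₀ ⊆ I₁ ⊆ ⋯ ⊆ I_r = S` and monomial
prime ideals `P₁, …, P_r` with `I_j / I_{j-1} ≅ S / P_j` as `S`-modules, such that `i < j` and
`P_i ⊆ P_j` imply `P_i = P_j`. (In the code the `P`s are numbered from `0`.) -/
def IsPrettyClean (I : Ideal (MvPolynomial σ K)) : Prop :=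
  ∃ (r : ℕ) (F : Fin (r + 1) → Ideal (MvPolynomial σ K)) (P : Fin r → Ideal (MvPolynomial σ K)),
    F 0 = I ∧ F (Fin.last r) = ⊤ ∧
    (∀ j : Fin r, F j.castSucc ≤ F j.succ) ∧
    (∀ j : Fin r, (P j).IsPrime ∧ IsMonomialIdeal (P j)) ∧
    (∀ j : Fin r, Nonempty
      ((↥(F j.succ) ⧸ (F j.castSucc).submoduleOf (F j.succ)) ≃ₗ[MvPolynomial σ K]
        (MvPolynomial σ K ⧸ P j))) ∧
    (∀ i j : Fin r, i < j → P i ≤ P j → P i = P j)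

end ForestType

/-! A monomial ideal is handled through the upper set `U` of the exponent vectors of its monomials.
Call a finite set `A` of monomials a forest if every nonempty subset has a leaf; `A` need not be the
minimal set of generators of the ideal `U` it spans. After redundant members are dropped, a leaf `u`
of the forest has a variable `x` whose exponent in `u` exceeds its exponent in all other members
(`IsForest.exists_lt_apply`). Put `f = u / x`. Then

* `U + (f)` is generated by `A` with `u` replaced by `f`, and no gcd of two distinct members has
  changed;
* `U : f` is generated by `x` and the monomials `w / gcd(w, f)` for `w ≠ u`, which do not involve
  `x`.

Both are again forests, up to the isolated variable `x`, and both are smaller. So prime filtrations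
of `U : f` and of `U + (f)` can be concatenated to one of `U`. The primes do not come out in the
order demanded of a pretty clean filtration, though. This is repaired by working separately in each
layer of the filtration by height: let `codimPart U h` be the ideal of all `s` such that `U : s` has
height at least `h`, and ask for a chain from `codimPart U (h + 1)` to `codimPart U h` whose primes
all have height `h` (`LayerwiseClean`). Such chains of `U : f` and `U + (f)` still combine
(`LayerwiseClean.of_colon_of_add`), provided that a monomial `s` outside `(f)` that lies in
`codimPart (U + (f)) h` lies in `codimPart U h`; this is shown by exchanging variables in a cover
(`mem_codimPart_of_not_le`). Finally the chains of all layers are strung together. The heights of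
the primes are then nonincreasing, hence an inclusion of an earlier prime in a later one is an
equality.
-/

namespace ForestType

/-! ### Forests of monomials -/

section Forest

variable {σ : Type*}

/-- A set of monomials, given by exponent vectors, is a forest if each of its nonempty subsets has
a leaf. It need not be an antichain, so that it may be a redundant set of generators. -/
def IsForest (A : Set (σ →₀ ℕ)) : Prop :=
  ∀ B ⊆ A, B.Nonempty → ∃ u, IsLeaf B u

theorem IsForest.mono {A B : Set (σ →₀ ℕ)} (hA : IsForest A) (h : B ⊆ A) : IsForest B :=
  fun C hC hne => hA C (hC.trans h) hne

/-- Forests are preserved by maps, not necessarily injective, that respect the comparisons of gcds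
between distinct members: a leaf of a set of representatives of `B ⊆ φ '' A` maps to a leaf
of `B`. -/
theorem IsForest.image {A : Set (σ →₀ ℕ)} (hA : IsForest A) (φ : (σ →₀ ℕ) → (σ →₀ ℕ))
    (hφ : ∀ a ∈ A, ∀ b ∈ A, ∀ c ∈ A, b ≠ a → c ≠ a → a ⊓ b ≤ a ⊓ c → φ a ⊓ φ b ≤ φ a ⊓ φ c) :
    IsForest (φ '' A) := by
  intro B hB hne
  have hsurj : Set.SurjOn φ A B := hB
  obtain ⟨B₀, hB₀, hbij⟩ := hsurj.exists_bijOn_subset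
  have himg : φ '' B₀ = B := hbij.image_eq
  have hne₀ : B₀.Nonempty := by
    rw [← himg] at hne
    exact hne.of_image
  obtain ⟨u, hu, hleaf⟩ := hA B₀ hB₀ hne₀
  refine ⟨φ u, hbij.mapsTo hu, ?_⟩
  rcases hleaf with rfl | ⟨v, hv, hvu, hw⟩
  · left
    rw [← himg, Set.image_singleton]
  · right
    refine ⟨φ v, hbij.mapsTo hv, fun h => hvu (hbij.injOn hv hu h), ?_⟩
    intro w hwB hwu
    rw [← himg] at hwB
    obtain ⟨w, hw₀, rfl⟩ := hwB
    have hne : w ≠ u := fun h => hwu (by rw [h])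
    exact hφ u (hB₀ hu) w (hB₀ hw₀) v (hB₀ hv) hne hvu (hw w hw₀ hne)

/-- Dividing each member `a` of a forest by `gcd(a, f)` gives a forest. -/
theorem IsForest.image_tsub {A : Set (σ →₀ ℕ)} (hA : IsForest A) (f : σ →₀ ℕ) :
    IsForest ((fun a => a - f) '' A) := by
  refine hA.image _ fun a _ b _ c _ _ _ h => ?_
  rw [Finsupp.le_def] at h ⊢
  intro i
  have := h i
  simp only [Finsupp.inf_apply, Finsupp.tsub_apply] at this ⊢
  omega

/-- If `u` is the only member of a forest with a maximal power of `x_i`, then `u` may be divided by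
`x_i`: this changes no gcd of two distinct members. -/
theorem IsForest.insert_tsub_single [DecidableEq σ] {A : Finset (σ →₀ ℕ)}
    (hA : IsForest (A : Set (σ →₀ ℕ))) {u : σ →₀ ℕ} (hu : u ∈ A) {i : σ}
    (hi : ∀ w ∈ A, w ≠ u → w i < u i) :
    IsForest (↑(insert (u - Finsupp.single i 1) (A.erase u)) : Set (σ →₀ ℕ)) := by
  have hinf : ∀ w ∈ A, w ≠ u → (u - Finsupp.single i 1) ⊓ w = u ⊓ w := by
    intro w hw hwu
    ext j
    have := hi w hw hwu
    by_cases hj : i = j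
    · subst hj
      simp only [Finsupp.inf_apply, Finsupp.tsub_apply, Finsupp.single_eq_same]
      omega
    · simp [hj]
  let φ : (σ →₀ ℕ) → (σ →₀ ℕ) := Function.update id u (u - Finsupp.single i 1)
  have hφu : φ u = u - Finsupp.single i 1 := Function.update_self ..
  have hφ : ∀ w, w ≠ u → φ w = w := fun w hw => Function.update_of_ne hw ..
  have hpair : ∀ a ∈ A, ∀ b ∈ A, b ≠ a → φ a ⊓ φ b = a ⊓ b := by
    intro a ha b hb hba
    by_cases hau : a = u
    · subst hau
      rw [hφu, hφ b hba, hinf b hb hba]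
    · by_cases hbu : b = u
      · subst hbu
        rw [hφu, hφ a hau, inf_comm, hinf a ha hau, inf_comm]
      · rw [hφ a hau, hφ b hbu]
  refine (hA.image φ fun a ha b hb c hc hba hca h => ?_).mono ?_
  · rwa [hpair a ha b hb hba, hpair a ha c hc hca]
  · intro w hw
    rcases Finset.mem_insert.1 (Finset.mem_coe.1 hw) with rfl | hw
    · exact ⟨u, hu, hφu⟩
    · exact ⟨w, Finset.mem_of_mem_erase hw, hφ w (Finset.ne_of_mem_erase hw)⟩

/-- In a leaf `u` that does not divide its branch `v`, some variable has a higher exponent than in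
`gcd(u, v)`, hence than in every other member. -/
theorem IsForest.exists_lt_apply {A : Set (σ →₀ ℕ)} (hA : IsForest A) (hne : A.Nonempty)
    (h0 : 0 ∉ A) (hred : ∀ u ∈ A, ∀ v ∈ A, u ≤ v → u = v) :
    ∃ u ∈ A, ∃ i, 0 < u i ∧ ∀ w ∈ A, w ≠ u → w i < u i := by
  obtain ⟨u, hu, rfl | ⟨v, hv, hvu, hw⟩⟩ := hA A subset_rfl hne
  · have hu0 : u ≠ 0 := fun h => h0 (by simp [h])
    obtain ⟨i, hi⟩ := DFunLike.ne_iff.1 hu0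
    refine ⟨u, rfl, i, Nat.pos_of_ne_zero hi, fun w hw hwu => absurd hw hwu⟩
  · have hnle : ¬ u ≤ v := fun h => hvu (hred u hu v hv h).symm
    rw [Finsupp.le_def, not_forall] at hnle
    obtain ⟨i, hi⟩ := hnle
    refine ⟨u, hu, i, by omega, fun w hwA hwu => ?_⟩
    have := Finsupp.le_def.1 (hw w hwA hwu) i
    simp only [Finsupp.inf_apply] at this
    omega

end Forest

/-! ### Prime filtrations of upper sets of exponent vectors -/

section Filtration

variable {σ : Type*}

/-- The exponent vectors of the monomials in the prime ideal `(x_i : i ∈ C)`. -/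
def primeSet (C : Finset σ) : Set (σ →₀ ℕ) :=
  {s | ∃ i ∈ C, s i ≠ 0}

/-- `PrimeStep h U V`: the monomial ideal `V` arises from the monomial ideal `U` by adding one
monomial `g` for which `U : g` is the monomial prime ideal of a set of `h` variables. The ideals
are represented by the exponent vectors of their monomials. -/
def PrimeStep (h : ℕ) (U V : Set (σ →₀ ℕ)) : Prop :=
  ∃ (g : σ →₀ ℕ) (C : Finset σ), C.card = h ∧ (∀ s, s + g ∈ U ↔ s ∈ primeSet C) ∧
    V = U ∪ Set.Ici g

theorem PrimeStep.subset {h : ℕ} {U V : Set (σ →₀ ℕ)} (H : PrimeStep h U V) : U ⊆ V := by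
  obtain ⟨g, C, -, -, rfl⟩ := H
  exact Set.subset_union_left

/-- `U` and `V` are joined by a chain of steps whose primes all have height `h`. -/
abbrev PrimeChain (h : ℕ) : Set (σ →₀ ℕ) → Set (σ →₀ ℕ) → Prop :=
  Relation.ReflTransGen (PrimeStep h)

theorem PrimeChain.subset {h : ℕ} {U V : Set (σ →₀ ℕ)} (H : PrimeChain h U V) : U ⊆ V := by
  induction H with
  | refl => exact subset_rfl
  | tail _ h ih => exact ih.trans h.subset

/-- Multiplication by the monomial `f` turns a chain above `X ⊇ E : f` into a chain above `E`. -/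
theorem PrimeChain.shift {h : ℕ} {E X Y : Set (σ →₀ ℕ)} (f : σ →₀ ℕ)
    (hE : ∀ s, s + f ∈ E → s ∈ X) (H : PrimeChain h X Y) :
    PrimeChain h (E ∪ (· + f) '' X) (E ∪ (· + f) '' Y) := by
  induction H with
  | refl => exact .refl
  | @tail Y Y' hXY hstep ih =>
    refine ih.tail ?_
    have hXY' := PrimeChain.subset hXY
    obtain ⟨g, C, hC, hg, rfl⟩ := hstep
    refine ⟨g + f, C, hC, fun s => ?_, ?_⟩
    · rw [← hg, ← add_assoc]
      constructor
      · rintro (h | ⟨t, ht, hts⟩)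
        · exact hXY' (hE _ h)
        · rwa [← add_right_cancel hts]
      · exact fun h => Or.inr ⟨_, h, rfl⟩
    · rw [Set.image_union, ← Set.union_assoc]
      congr 1
      ext s
      constructor
      · rintro ⟨t, ht, rfl⟩
        exact add_le_add_left ht f
      · intro hs
        have hs : g + f ≤ s := hs
        have hfs : f ≤ s := le_trans le_add_self hs
        exact ⟨s - f, le_tsub_of_add_le_right hs, tsub_add_cancel_of_le hfs⟩

/-- A chain survives intersection with an upper set `E`, provided that the part of its end outside
its beginning lies in `E`. -/
theorem PrimeChain.inter {h : ℕ} {E X Y : Set (σ →₀ ℕ)} (hE : IsUpperSet E)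
    (H : PrimeChain h X Y) (hYE : Y \ X ⊆ E) : PrimeChain h (X ∩ E) (Y ∩ E) := by
  induction H with
  | refl => exact .refl
  | @tail Y Y' hXY hstep ih =>
    have hYY' := hstep.subset
    have hXY' := PrimeChain.subset hXY
    refine (ih (fun s hs => hYE ⟨hYY' hs.1, hs.2⟩)).tail ?_
    obtain ⟨g, C, hC, hg, rfl⟩ := hstep
    have hgY : g ∉ Y := by
      intro h
      obtain ⟨i, -, hi⟩ := (hg 0).1 (by rwa [zero_add])
      exact hi rfl
    have hgE : g ∈ E := hYE ⟨Or.inr (le_refl g), fun h => hgY (hXY' h)⟩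
    refine ⟨g, C, hC, fun s => ?_, ?_⟩
    · rw [← hg]
      exact ⟨fun h => h.1, fun h => ⟨h, hE le_add_self hgE⟩⟩
    · rw [Set.union_inter_distrib_right, Set.inter_eq_left.2 (hE.Ici_subset hgE)]

/-! ### The filtration by height -/

/-- `codimPart U h` consists of the monomials `s` for which every monomial prime ideal containing
`U : s` has height at least `h`. For `h` larger than the number of variables this is `U`, and for
`h = 0` it is everything. -/
def codimPart (U : Set (σ →₀ ℕ)) (h : ℕ) : Set (σ →₀ ℕ) :=
  {s | ∀ C : Finset σ, (∀ t, t + s ∈ U → t ∈ primeSet C) → h ≤ C.card}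

theorem codimPart_zero (U : Set (σ →₀ ℕ)) : codimPart U 0 = Set.univ :=
  Set.eq_univ_of_forall fun _ _ _ => Nat.zero_le _

theorem codimPart_mono {U V : Set (σ →₀ ℕ)} (h : U ⊆ V) (k : ℕ) :
    codimPart U k ⊆ codimPart V k :=
  fun _ hs C hC => hs C fun t ht => hC t (h ht)

theorem codimPart_antitone (U : Set (σ →₀ ℕ)) : Antitone (codimPart U) :=
  fun _ _ h _ hs C hC => h.trans (hs C hC)

theorem subset_codimPart (U : Set (σ →₀ ℕ)) (h : ℕ) : U ⊆ codimPart U h := by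
  intro s hs C hC
  obtain ⟨i, -, hi⟩ := hC 0 (by rwa [zero_add])
  exact absurd rfl hi

theorem isUpperSet_codimPart {U : Set (σ →₀ ℕ)} (hU : IsUpperSet U) (h : ℕ) :
    IsUpperSet (codimPart U h) :=
  fun _ _ hab ha C hC => ha C fun t ht => hC t (hU (add_le_add_right hab t) ht)

theorem codimPart_eq_self [Fintype σ] {U : Set (σ →₀ ℕ)} {h : ℕ} (hh : Fintype.card σ < h) :
    codimPart U h = U := by
  refine (Set.Subset.antisymm ?_ (subset_codimPart U h))
  intro s hs
  by_contra hsU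
  -- The ideal `U : s` is proper, so the set of all variables covers it.
  have := hs Finset.univ fun t ht => by
    have ht0 : t ≠ 0 := by
      rintro rfl
      exact hsU (by simpa using ht)
    obtain ⟨i, hi⟩ := DFunLike.ne_iff.1 ht0
    exact ⟨i, Finset.mem_univ i, hi⟩
  rw [Finset.card_univ] at this
  omega

theorem add_mem_codimPart {U : Set (σ →₀ ℕ)} {f s : σ →₀ ℕ} {h : ℕ} :
    s + f ∈ codimPart U h ↔ s ∈ codimPart {t | t + f ∈ U} h := by
  simp only [codimPart, Set.mem_ofPred_eq, add_assoc]

/-- `U` admits, for each `h`, a chain with primes of height `h` through the `h`-th layer of its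
filtration by height. -/
def LayerwiseClean (U : Set (σ →₀ ℕ)) : Prop :=
  ∀ h, PrimeChain h (codimPart U (h + 1)) (codimPart U h)

theorem layerwiseClean_univ : LayerwiseClean (Set.univ : Set (σ →₀ ℕ)) := by
  intro h
  have : ∀ k, codimPart (Set.univ : Set (σ →₀ ℕ)) k = Set.univ :=
    fun k => Set.eq_univ_of_univ_subset (subset_codimPart _ k)
  rw [this, this]

theorem codimPart_primeSet_of_le {C : Finset σ} {h : ℕ} (hC : h ≤ C.card) :
    codimPart (primeSet C) h = Set.univ := by
  refine Set.eq_univ_of_forall fun s D hD => hC.trans (Finset.card_le_card fun i hi => ?_)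
  obtain ⟨j, hj, hij⟩ := hD (Finsupp.single i 1) ⟨i, hi, by simp⟩
  by_cases h : i = j
  · rwa [h]
  · exact absurd (Finsupp.single_eq_of_ne (Ne.symm h)) hij

theorem codimPart_primeSet_of_lt {C : Finset σ} {h : ℕ} (hC : C.card < h) :
    codimPart (primeSet C) h = primeSet C := by
  refine Set.Subset.antisymm (fun s hs => ?_) (subset_codimPart _ h)
  by_contra hsC
  have := hs C fun t ht => by
    obtain ⟨i, hi, hti⟩ := ht
    refine ⟨i, hi, fun h0 => hsC ⟨i, hi, fun h1 => hti ?_⟩⟩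
    rw [Finsupp.add_apply, h0, h1]
  omega

theorem layerwiseClean_primeSet (C : Finset σ) : LayerwiseClean (primeSet C) := by
  intro h
  rcases lt_trichotomy C.card h with hC | hC | hC
  · rw [codimPart_primeSet_of_lt hC, codimPart_primeSet_of_lt (by omega)]
  · rw [codimPart_primeSet_of_le hC.ge, codimPart_primeSet_of_lt (by omega)]
    refine .single ⟨0, C, hC, fun s => by rw [add_zero], ?_⟩
    rw [eq_comm, Set.eq_univ_iff_forall]
    exact fun s => Or.inr (zero_le (a := s))
  · rw [codimPart_primeSet_of_le hC.le, codimPart_primeSet_of_le (by omega)]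

/-- Layerwise cleanness of `U : f` and of `U + (f)` gives that of `U`, if passing from `U` to
`U + (f)` does not raise the height of the colon ideal by a monomial outside `(f)`. -/
theorem LayerwiseClean.of_colon_of_add {U : Set (σ →₀ ℕ)} (hU : IsUpperSet U) (f : σ →₀ ℕ)
    (hf : ∀ h, ∀ s ∈ codimPart (U ∪ Set.Ici f) h, ¬ f ≤ s → s ∈ codimPart U h)
    (hcolon : LayerwiseClean {s | s + f ∈ U}) (hadd : LayerwiseClean (U ∪ Set.Ici f)) :
    LayerwiseClean U := by
  intro h
  have hshift : ∀ k, (· + f) '' codimPart {s | s + f ∈ U} k = codimPart U k ∩ Set.Ici f := by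
    intro k
    ext s
    constructor
    · rintro ⟨t, ht, rfl⟩
      exact ⟨add_mem_codimPart.2 ht, Set.mem_Ici.2 le_add_self⟩
    · rintro ⟨hs, hfs⟩
      refine ⟨s - f, add_mem_codimPart.1 ?_, tsub_add_cancel_of_le hfs⟩
      rwa [tsub_add_cancel_of_le hfs]
  have hanti : codimPart U (h + 1) ⊆ codimPart U h := codimPart_antitone U h.le_succ
  have hIci : ∀ k, Set.Ici f ⊆ codimPart (U ∪ Set.Ici f) k :=
    fun k => Set.subset_union_right.trans (subset_codimPart _ k)
  have h₁ := PrimeChain.shift (E := codimPart U (h + 1)) f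
    (fun s hs => add_mem_codimPart.1 hs) (hcolon h)
  rw [hshift, hshift, Set.union_eq_left.2 Set.inter_subset_left] at h₁
  have h₂ := PrimeChain.inter (isUpperSet_codimPart hU h) (hadd h) fun s hs =>
    hf h s hs.1 fun hfs => hs.2 (hIci _ hfs)
  rw [Set.inter_eq_right.2 (codimPart_mono Set.subset_union_left h)] at h₂
  refine h₁.trans ?_
  convert h₂ using 1
  ext s
  constructor
  · rintro (hs | hs)
    · exact ⟨codimPart_mono Set.subset_union_left _ hs, hanti hs⟩
    · exact ⟨hIci _ hs.2, hs.1⟩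
  · rintro ⟨hs, hsU⟩
    by_cases hfs : f ≤ s
    · exact Or.inr ⟨hsU, hfs⟩
    · exact Or.inl (hf _ s hs hfs)

/-! ### Forests are layerwise clean -/

/-- The exponent vectors of the monomials in the ideal generated by the variables in `Z` and the
monomials in `A`. -/
def upperHull (Z : Finset σ) (A : Set (σ →₀ ℕ)) : Set (σ →₀ ℕ) :=
  primeSet Z ∪ {s | ∃ a ∈ A, a ≤ s}

theorem isUpperSet_upperHull (Z : Finset σ) (A : Set (σ →₀ ℕ)) : IsUpperSet (upperHull Z A) := by
  rintro s t hst (⟨i, hi, hsi⟩ | ⟨a, ha, has⟩)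
  · refine Or.inl ⟨i, hi, fun h => hsi ?_⟩
    have := Finsupp.le_def.1 hst i
    omega
  · exact Or.inr ⟨a, ha, has.trans hst⟩

theorem upperHull_empty (Z : Finset σ) : upperHull Z (∅ : Set (σ →₀ ℕ)) = primeSet Z := by
  simp [upperHull]

theorem upperHull_erase [DecidableEq σ] {Z : Finset σ} {A : Finset (σ →₀ ℕ)} {u v : σ →₀ ℕ}
    (hu : u ∈ A) (huv : u ≤ v) (hne : u ≠ v) :
    upperHull Z (↑(A.erase v) : Set (σ →₀ ℕ)) = upperHull Z (A : Set (σ →₀ ℕ)) := by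
  unfold upperHull
  congr 1
  ext s
  constructor
  · rintro ⟨a, ha, has⟩
    exact ⟨a, Finset.mem_of_mem_erase ha, has⟩
  · rintro ⟨a, ha, has⟩
    by_cases hav : a = v
    · exact ⟨u, Finset.mem_erase.2 ⟨hne, hu⟩, huv.trans (hav ▸ has)⟩
    · exact ⟨a, Finset.mem_erase.2 ⟨hav, ha⟩, has⟩

section Split

variable [DecidableEq σ] {Z : Finset σ} {A : Finset (σ →₀ ℕ)} {f : σ →₀ ℕ} {x : σ}

/-- The colon ideal by `f` is generated by `x`, `Z` and the quotients `w / gcd(w, f)` of the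
generators `w` other than `f * x`. These quotients do not involve the variable `x`, whose exponent
in `w` is at most that in `f`. -/
theorem colon_upperHull (hu : f + Finsupp.single x 1 ∈ A)
    (hx : ∀ w ∈ A, w ≠ f + Finsupp.single x 1 → w x ≤ f x) (hZ : ∀ z ∈ Z, f z = 0) :
    {s | s + f ∈ upperHull Z (A : Set (σ →₀ ℕ))} =
      upperHull (insert x Z)
        (↑((A.erase (f + Finsupp.single x 1)).image (· - f)) : Set (σ →₀ ℕ)) := by
  ext s
  constructor
  · rintro (⟨z, hz, hsz⟩ | ⟨w, hw, hws⟩)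
    · refine Or.inl ⟨z, Finset.mem_insert_of_mem hz, ?_⟩
      rwa [Finsupp.add_apply, hZ z hz, add_zero] at hsz
    · by_cases hwu : w = f + Finsupp.single x 1
      · refine Or.inl ⟨x, Finset.mem_insert_self x Z, ?_⟩
        have := Finsupp.le_def.1 hws x
        simp only [hwu, Finsupp.add_apply, Finsupp.single_eq_same] at this
        omega
      · refine Or.inr ⟨w - f, ?_, tsub_le_iff_right.2 hws⟩
        exact Finset.mem_coe.2 (Finset.mem_image_of_mem _ (Finset.mem_erase.2 ⟨hwu, hw⟩))
  · rintro (⟨z, hz, hsz⟩ | ⟨w, hw, hws⟩)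
    · rcases Finset.mem_insert.1 hz with rfl | hz
      · refine Or.inr ⟨_, hu, ?_⟩
        rw [add_comm]
        exact add_le_add_left (Finsupp.single_le_iff.2 (Nat.one_le_iff_ne_zero.2 hsz)) f
      · refine Or.inl ⟨z, hz, ?_⟩
        rwa [Finsupp.add_apply, hZ z hz, add_zero]
    · obtain ⟨v, hv, rfl⟩ := Finset.mem_image.1 (Finset.mem_coe.1 hw)
      exact Or.inr ⟨v, Finset.mem_of_mem_erase hv, tsub_le_iff_right.1 hws⟩

theorem upperHull_union_Ici (hu : f + Finsupp.single x 1 ∈ A) :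
    upperHull Z (A : Set (σ →₀ ℕ)) ∪ Set.Ici f =
      upperHull Z (↑(insert f (A.erase (f + Finsupp.single x 1))) : Set (σ →₀ ℕ)) := by
  ext s
  constructor
  · rintro ((hs | ⟨w, hw, hws⟩) | hs)
    · exact Or.inl hs
    · by_cases hwu : w = f + Finsupp.single x 1
      · refine Or.inr ⟨f, Finset.mem_coe.2 (Finset.mem_insert_self ..), ?_⟩
        exact le_trans (by rw [hwu]; exact le_self_add) hws
      · exact Or.inr ⟨w, Finset.mem_coe.2
          (Finset.mem_insert_of_mem (Finset.mem_erase.2 ⟨hwu, hw⟩)), hws⟩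
    · exact Or.inr ⟨f, Finset.mem_coe.2 (Finset.mem_insert_self ..), hs⟩
  · rintro (hs | ⟨w, hw, hws⟩)
    · exact Or.inl (Or.inl hs)
    · rcases Finset.mem_insert.1 (Finset.mem_coe.1 hw) with rfl | hw
      · exact Or.inr hws
      · exact Or.inl (Or.inr ⟨w, Finset.mem_of_mem_erase hw, hws⟩)

/-- The height hypothesis of `LayerwiseClean.of_colon_of_add` for a forest. A cover `C` of `U : s`
that does not cover `(U + (f)) : s` must contain the variable `x`, and `s` has the same exponent
at `x` as `f`. Exchanging `x` for a variable `y` of `f / gcd(f, s)` gives a cover of `(U + (f)) : s` of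
the same size, because the remaining generators of `U : s` do not involve `x`. -/
theorem mem_codimPart_of_not_le (hu : f + Finsupp.single x 1 ∈ A)
    (hx : ∀ w ∈ A, w ≠ f + Finsupp.single x 1 → w x ≤ f x) (hxZ : x ∉ Z) {h : ℕ} {s : σ →₀ ℕ}
    (hs : s ∈ codimPart (upperHull Z (A : Set (σ →₀ ℕ)) ∪ Set.Ici f) h) (hfs : ¬ f ≤ s) :
    s ∈ codimPart (upperHull Z (A : Set (σ →₀ ℕ))) h := by
  intro C hC
  by_cases hcov : ∀ t, t + s ∈ upperHull Z (A : Set (σ →₀ ℕ)) ∪ Set.Ici f → t ∈ primeSet C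
  · exact hs C hcov
  push Not at hcov
  obtain ⟨t, hts, htC⟩ := hcov
  have htU : t + s ∉ upperHull Z (A : Set (σ →₀ ℕ)) := fun h => htC (hC t h)
  have hft : f ≤ t + s := hts.resolve_left htU
  have htx : t x + s x ≤ f x := by
    by_contra hlt
    refine htU (Or.inr ⟨_, hu, Finsupp.le_def.2 fun j => ?_⟩)
    have := Finsupp.le_def.1 hft j
    by_cases hj : x = j
    · subst hj
      simp only [Finsupp.add_apply, Finsupp.single_eq_same]
      omega
    · simpa [Finsupp.single_apply, hj] using this
  have hftC : t + Finsupp.single x 1 ∈ primeSet C := by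
    refine hC _ (Or.inr ⟨_, hu, ?_⟩)
    rw [add_right_comm]
    exact add_le_add_left hft _
  have hmiss : ∀ i ∈ C, t i = 0 := by
    intro i hi
    by_contra hti
    exact htC ⟨i, hi, hti⟩
  have hxC : x ∈ C := by
    obtain ⟨i, hi, hti⟩ := hftC
    by_cases hix : x = i
    · rwa [hix]
    · simp [hmiss i hi, hix] at hti
  have hsx : s x = f x := by
    have h₁ := Finsupp.le_def.1 hft x
    have h₂ := hmiss x hxC
    simp only [Finsupp.add_apply] at h₁
    omega
  rw [Finsupp.le_def, not_forall] at hfs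
  obtain ⟨y, hy⟩ := hfs
  have hyC : y ∉ C := by
    intro h
    have h₁ := Finsupp.le_def.1 hft y
    have h₂ := hmiss y h
    simp only [Finsupp.add_apply] at h₁
    omega
  have hcard : (insert y (C.erase x)).card = C.card := by
    rw [Finset.card_insert_of_notMem fun h => hyC (Finset.mem_of_mem_erase h),
      Finset.card_erase_add_one hxC]
  rw [← hcard]
  refine hs _ fun t' ht' => ?_
  by_cases hft' : f ≤ t' + s
  · refine ⟨y, Finset.mem_insert_self .., ?_⟩
    have := Finsupp.le_def.1 hft' y
    simp only [Finsupp.add_apply] at this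
    omega
  have ht'U := ht'.resolve_right hft'
  -- Setting the exponent at `x` to zero keeps `t' + s` in `U`.
  have hle : ∀ j, x ≠ j → (t'.erase x) j = t' j := fun j hj => Finsupp.erase_ne (Ne.symm hj)
  have herase : t'.erase x + s ∈ upperHull Z (A : Set (σ →₀ ℕ)) := by
    rcases ht'U with ⟨z, hz, hzt⟩ | ⟨w, hw, hwt⟩
    · refine Or.inl ⟨z, hz, ?_⟩
      rwa [Finsupp.add_apply, hle z fun h => hxZ (h ▸ hz), ← Finsupp.add_apply]
    · have hwu : w ≠ f + Finsupp.single x 1 := by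
        rintro rfl
        exact hft' (le_trans le_self_add hwt)
      refine Or.inr ⟨w, hw, Finsupp.le_def.2 fun j => ?_⟩
      by_cases hj : x = j
      · subst hj
        have := hx w hw hwu
        simp only [Finsupp.add_apply]
        omega
      · rw [Finsupp.add_apply, hle j hj, ← Finsupp.add_apply]
        exact Finsupp.le_def.1 hwt j
  obtain ⟨i, hi, hti⟩ := hC _ herase
  have hix : x ≠ i := by
    rintro rfl
    exact hti Finsupp.erase_same
  rw [hle i hix] at hti
  exact ⟨i, Finset.mem_insert_of_mem (Finset.mem_erase.2 ⟨hix.symm, hi⟩), hti⟩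

end Split

/-- The statement is proved together with a set `Z` of further variables, disjoint from the
variables of the forest, by induction on the sum of `degree a + 1` over `a ∈ A`. -/
theorem IsForest.layerwiseClean [DecidableEq σ] (A : Finset (σ →₀ ℕ)) (Z : Finset σ)
    (hA : IsForest (A : Set (σ →₀ ℕ))) (hZ : ∀ a ∈ A, ∀ z ∈ Z, a z = 0) :
    LayerwiseClean (upperHull Z (A : Set (σ →₀ ℕ))) := by
  by_cases hne : A = ∅
  · subst hne
    rw [Finset.coe_empty, upperHull_empty]
    exact layerwiseClean_primeSet Z
  by_cases h0 : 0 ∈ A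
  · have : upperHull Z (A : Set (σ →₀ ℕ)) = Set.univ :=
      Set.eq_univ_of_forall fun s => Or.inr ⟨0, h0, zero_le (a := s)⟩
    rw [this]
    exact layerwiseClean_univ
  by_cases hred : ∀ u ∈ A, ∀ v ∈ A, u ≤ v → u = v
  swap
  · push Not at hred
    obtain ⟨u, hu, v, hv, huv, hne⟩ := hred
    have hdec := Finset.sum_erase_add A (fun a => a.degree + 1) hv
    rw [← upperHull_erase hu huv hne]
    exact IsForest.layerwiseClean (A.erase v) Z (hA.mono (by simp))
      fun a ha => hZ a (Finset.mem_of_mem_erase ha)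
  obtain ⟨u, hu, x, hux, hlt⟩ := hA.exists_lt_apply
    (Finset.coe_nonempty.2 (Finset.nonempty_iff_ne_empty.2 hne)) (by simpa using h0)
    (by simpa using hred)
  simp only [Finset.mem_coe] at hu hlt
  have hinsert := hA.insert_tsub_single hu hlt
  have htsub := (hA.mono (Finset.coe_subset.2 (Finset.erase_subset u A))).image_tsub
    (u - Finsupp.single x 1)
  obtain ⟨f, rfl⟩ : ∃ f, u = f + Finsupp.single x 1 :=
    ⟨u - Finsupp.single x 1, (tsub_add_cancel_of_le (Finsupp.single_le_iff.2 hux)).symm⟩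
  rw [add_tsub_cancel_right] at hinsert htsub
  have hx : ∀ w ∈ A, w ≠ f + Finsupp.single x 1 → w x ≤ f x := by
    intro w hw hwu
    have := hlt w hw hwu
    simp only [Finsupp.add_apply, Finsupp.single_eq_same] at this
    omega
  have hxZ : x ∉ Z := fun h => hux.ne' (hZ _ hu x h)
  have hfZ : ∀ z ∈ Z, f z = 0 := fun z hz => by
    have := hZ _ hu z hz
    simp only [Finsupp.add_apply] at this
    omega
  have hdec := Finset.sum_erase_add A (fun a => a.degree + 1) hu
  have hdeg : (f + Finsupp.single x 1).degree = f.degree + 1 := by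
    rw [map_add, Finsupp.degree_single]
  have hdec₁ : ∑ a ∈ (A.erase (f + Finsupp.single x 1)).image (· - f), (a.degree + 1) ≤
      ∑ a ∈ A.erase (f + Finsupp.single x 1), (a.degree + 1) :=
    (Finset.sum_image_le_of_nonneg fun _ _ => Nat.zero_le _).trans
      (Finset.sum_le_sum fun a _ => Nat.add_le_add_right (Finsupp.degree_mono tsub_le_self) 1)
  have hdec₂ : ∑ a ∈ insert f (A.erase (f + Finsupp.single x 1)), (a.degree + 1) ≤
      (f.degree + 1) + ∑ a ∈ A.erase (f + Finsupp.single x 1), (a.degree + 1) := by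
    by_cases hf : f ∈ A.erase (f + Finsupp.single x 1)
    · rw [Finset.insert_eq_of_mem hf]
      exact Nat.le_add_left ..
    · rw [Finset.sum_insert hf]
  refine LayerwiseClean.of_colon_of_add (isUpperSet_upperHull ..) f
    (fun h s hs hfs => mem_codimPart_of_not_le hu hx hxZ hs hfs) ?_ ?_
  · rw [colon_upperHull hu hx hfZ]
    refine IsForest.layerwiseClean _ _ (by rwa [Finset.coe_image]) fun a ha z hz => ?_
    obtain ⟨w, hw, rfl⟩ := Finset.mem_image.1 ha
    obtain ⟨hwu, hwA⟩ := Finset.mem_erase.1 hw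
    rw [Finsupp.tsub_apply]
    rcases Finset.mem_insert.1 hz with rfl | hz
    · exact Nat.sub_eq_zero_of_le (hx w hwA hwu)
    · rw [hZ w hwA z hz, Nat.zero_sub]
  · rw [upperHull_union_Ici hu]
    refine IsForest.layerwiseClean _ _ hinsert fun a ha z hz => ?_
    rcases Finset.mem_insert.1 ha with rfl | ha
    · exact hfZ z hz
    · exact hZ a (Finset.mem_of_mem_erase ha) z hz
termination_by ∑ a ∈ A, (a.degree + 1)
decreasing_by all_goals omega

/-! ### Concatenating the layers -/

/-- A prime filtration from `U` to the whole ring, with the heights of the primes nonincreasing and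
bounded by `h`. -/
def HeightSorted (h : ℕ) (U : Set (σ →₀ ℕ)) : Prop :=
  ∃ (r : ℕ) (F : Fin (r + 1) → Set (σ →₀ ℕ)) (C : Fin r → Finset σ),
    F 0 = U ∧ F (Fin.last r) = Set.univ ∧ (∀ j, (C j).card ≤ h) ∧
    (∀ i j, i ≤ j → (C j).card ≤ (C i).card) ∧
    ∀ j : Fin r, ∃ g, (∀ s, s + g ∈ F j.castSucc ↔ s ∈ primeSet (C j)) ∧
      F j.succ = F j.castSucc ∪ Set.Ici g

theorem HeightSorted.cons {h : ℕ} {U V : Set (σ →₀ ℕ)} (hUV : PrimeStep h U V)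
    (H : HeightSorted h V) : HeightSorted h U := by
  obtain ⟨r, F, C, h0, hlast, hle, hanti, hstep⟩ := H
  obtain ⟨g, D, hD, hg, hV⟩ := hUV
  refine ⟨r + 1, Fin.cons U F, Fin.cons D C, rfl, ?_, ?_, ?_, ?_⟩
  · rw [← Fin.succ_last, Fin.cons_succ, hlast]
  · exact Fin.cases hD.le hle
  · intro i j hij
    induction i using Fin.cases with
    | zero =>
      induction j using Fin.cases with
      | zero => exact le_rfl
      | succ j => simpa [hD] using hle j
    | succ i =>
      induction j using Fin.cases with
      | zero => exact absurd hij (by simp)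
      | succ j => simpa using hanti i j (Fin.succ_le_succ_iff.1 hij)
  · intro j
    induction j using Fin.cases with
    | zero =>
      refine ⟨g, hg, ?_⟩
      rw [Fin.cons_succ, h0, hV]
      rfl
    | succ j =>
      obtain ⟨g, hg, hj⟩ := hstep j
      rw [← Fin.succ_castSucc, Fin.cons_succ, Fin.cons_succ, Fin.cons_succ]
      exact ⟨g, hg, hj⟩

theorem LayerwiseClean.heightSorted {U : Set (σ →₀ ℕ)} (hU : LayerwiseClean U) (h : ℕ) :
    HeightSorted h (codimPart U (h + 1)) := by
  have key : ∀ k, HeightSorted k (codimPart U k) → HeightSorted k (codimPart U (k + 1)) := by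
    intro k hk
    exact Relation.ReflTransGen.head_induction_on (hU k) hk fun hstep _ ih => ih.cons hstep
  induction h with
  | zero =>
    refine key 0 ?_
    rw [codimPart_zero]
    exact ⟨0, fun _ => Set.univ, Fin.elim0, rfl, rfl, fun j => j.elim0, fun j => j.elim0,
      fun j => j.elim0⟩
  | succ h ih =>
    refine key (h + 1) ?_
    obtain ⟨r, F, C, h0, hlast, hle, H⟩ := ih
    exact ⟨r, F, C, h0, hlast, fun j => (hle j).trans h.le_succ, H⟩

end Filtration

/-! ### From exponent vectors to ideals -/

section Ideals

variable {σ : Type*} (K : Type*) [Field K]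

/-- The ideal generated by the monomials with exponent vectors in `U`. -/
noncomputable def monomialSpan (U : Set (σ →₀ ℕ)) : Ideal (MvPolynomial σ K) :=
  Ideal.span ((fun a => monomial a (1 : K)) '' U)

variable {K}

theorem mem_monomialSpan {U : Set (σ →₀ ℕ)} (hU : IsUpperSet U) {p : MvPolynomial σ K} :
    p ∈ monomialSpan K U ↔ ∀ s, coeff s p ≠ 0 → s ∈ U := by
  rw [monomialSpan, mem_ideal_span_monomial_image]
  simp only [mem_support_iff]
  exact ⟨fun h s hs => by obtain ⟨t, ht, hts⟩ := h s hs; exact hU hts ht,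
    fun h s hs => ⟨s, h s hs, le_rfl⟩⟩

theorem isUpperSet_primeSet (C : Finset σ) : IsUpperSet (primeSet C) := by
  rintro s t hst ⟨i, hi, hsi⟩
  refine ⟨i, hi, fun h => hsi ?_⟩
  have := Finsupp.le_def.1 hst i
  omega

theorem monomialSpan_primeSet (C : Finset σ) :
    monomialSpan K (primeSet C) = Ideal.span (X '' (C : Set σ)) := by
  ext p
  rw [mem_monomialSpan (isUpperSet_primeSet C), mem_ideal_span_X_image]
  simp [primeSet]

/-- The ideal is the kernel of the endomorphism killing the variables in `C` and fixing the
others. -/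
theorem isPrime_monomialSpan_primeSet (C : Finset σ) :
    (monomialSpan K (primeSet C)).IsPrime := by
  classical
  let φ : MvPolynomial σ K →ₐ[K] MvPolynomial σ K := aeval fun i => if i ∈ C then 0 else X i
  have hmk : (Ideal.Quotient.mkₐ K (monomialSpan K (primeSet C))).comp φ =
      Ideal.Quotient.mkₐ K (monomialSpan K (primeSet C)) := by
    ext i
    by_cases hi : i ∈ C
    · have : (X i : MvPolynomial σ K) ∈ monomialSpan K (primeSet C) := by
        rw [monomialSpan_primeSet]
        exact Ideal.subset_span ⟨i, hi, rfl⟩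
      simpa [φ, hi] using (Ideal.Quotient.eq_zero_iff_mem.2 this).symm
    · simp [φ, hi]
  have hker : monomialSpan K (primeSet C) = RingHom.ker φ := by
    refine le_antisymm ?_ fun p hp => ?_
    · rw [monomialSpan_primeSet, Ideal.span_le]
      rintro _ ⟨i, hi, rfl⟩
      have hi : i ∈ C := hi
      simp [φ, hi]
    · have := DFunLike.congr_fun hmk p
      rw [AlgHom.comp_apply, (RingHom.mem_ker).1 hp, map_zero] at this
      exact Ideal.Quotient.eq_zero_iff_mem.1 this.symm
  rw [hker]
  exact RingHom.ker_isPrime φ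

/-- Adding to `U` a monomial `g` with `U : g = (x_i : i ∈ C)` gives a quotient isomorphic to
`S ⧸ (x_i : i ∈ C)`, via multiplication by `g`. -/
theorem nonempty_quotient_equiv {U V : Set (σ →₀ ℕ)} (hU : IsUpperSet U) {g : σ →₀ ℕ}
    {C : Finset σ} (hg : ∀ s, s + g ∈ U ↔ s ∈ primeSet C) (hUV : V = U ∪ Set.Ici g) :
    Nonempty ((↥(monomialSpan K V) ⧸
        (monomialSpan K U).submoduleOf (monomialSpan K V))
      ≃ₗ[MvPolynomial σ K] (MvPolynomial σ K ⧸ monomialSpan K (primeSet C))) := by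
  have hV : IsUpperSet V := hUV ▸ hU.union (isUpperSet_Ici g)
  have hmem : (monomial g (1 : K)) ∈ monomialSpan K V :=
    Ideal.subset_span ⟨g, hUV ▸ Or.inr (le_refl g), rfl⟩
  let ψ : MvPolynomial σ K →ₗ[MvPolynomial σ K]
      (↥(monomialSpan K V) ⧸
        (monomialSpan K U).submoduleOf (monomialSpan K V)) :=
    (Submodule.mkQ _).comp (LinearMap.toSpanSingleton _ _ ⟨monomial g (1 : K), hmem⟩)
  have hψ : Function.Surjective ψ := by
    intro q
    obtain ⟨⟨p, hp⟩, rfl⟩ := Submodule.mkQ_surjective _ q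
    refine ⟨p.divMonomial g, ?_⟩
    rw [LinearMap.comp_apply, ← sub_eq_zero, ← map_sub, Submodule.mkQ_apply,
      Submodule.Quotient.mk_eq_zero, Submodule.submoduleOf,
      Submodule.mem_comap, Submodule.subtype_apply]
    simp only [LinearMap.toSpanSingleton_apply, AddSubgroupClass.coe_sub, SetLike.val_smul,
      smul_eq_mul]
    rw [← neg_mem_iff, neg_sub, mul_comm, sub_eq_of_eq_add' (divMonomial_add_modMonomial p g).symm,
      mem_monomialSpan hU]
    intro s hs
    by_cases hgs : g ≤ s
    · exact absurd (coeff_modMonomial_of_le p hgs) hs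
    · rw [coeff_modMonomial_of_not_le p hgs] at hs
      have hsV := (mem_monomialSpan hV).1 hp s hs
      rw [hUV] at hsV
      exact hsV.resolve_right hgs
  have hker : LinearMap.ker ψ = monomialSpan K (primeSet C) := by
    ext p
    rw [LinearMap.mem_ker, LinearMap.comp_apply, Submodule.mkQ_apply,
      Submodule.Quotient.mk_eq_zero, Submodule.submoduleOf,
      Submodule.mem_comap, Submodule.subtype_apply]
    simp only [LinearMap.toSpanSingleton_apply, SetLike.val_smul, smul_eq_mul]
    rw [mem_monomialSpan hU, mem_monomialSpan (isUpperSet_primeSet C)]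
    constructor
    · intro h s hs
      rw [← hg]
      refine h _ ?_
      rwa [coeff_mul_monomial, mul_one]
    · intro h s hs
      rw [coeff_mul_monomial'] at hs
      split_ifs at hs with hgs
      · rw [mul_one] at hs
        have := (hg _).2 (h _ hs)
        rwa [tsub_add_cancel_of_le hgs] at this
      · exact absurd rfl hs
  exact ⟨((Submodule.quotEquivOfEq _ _ hker.symm).trans (ψ.quotKerEquivOfSurjective hψ)).symm⟩

theorem HeightSorted.isPrettyClean {U : Set (σ →₀ ℕ)} (hU : IsUpperSet U) {h : ℕ}
    (H : HeightSorted h U) : IsPrettyClean (monomialSpan K U) := by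
  obtain ⟨r, F, C, h0, hlast, -, hanti, hstep⟩ := H
  have hF : ∀ j, IsUpperSet (F j) := by
    intro j
    induction j using Fin.induction with
    | zero => rwa [h0]
    | succ j ih =>
      obtain ⟨g, -, hj⟩ := hstep j
      rw [hj]
      exact ih.union (isUpperSet_Ici g)
  refine ⟨r, fun j => monomialSpan K (F j), fun j => monomialSpan K (primeSet (C j)), ?_, ?_, ?_,
    ?_, ?_, ?_⟩
  · simp only [h0]
  · rw [Ideal.eq_top_iff_one, mem_monomialSpan (hF _), hlast]
    exact fun _ _ => Set.mem_univ _
  · intro j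
    obtain ⟨g, -, hj⟩ := hstep j
    refine Ideal.span_mono (Set.image_mono ?_)
    rw [hj]
    exact Set.subset_union_left
  · exact fun j => ⟨isPrime_monomialSpan_primeSet (C j), primeSet (C j), rfl⟩
  · intro j
    obtain ⟨g, hg, hj⟩ := hstep j
    exact nonempty_quotient_equiv (hF _) hg hj
  · intro i j hij hle
    have hsub : C i ⊆ C j := by
      intro x hx
      have hX : (X x : MvPolynomial σ K) ∈ monomialSpan K (primeSet (C i)) := by
        rw [monomialSpan_primeSet]
        exact Ideal.subset_span ⟨x, hx, rfl⟩
      obtain ⟨y, hy, hxy⟩ := (mem_monomialSpan (isUpperSet_primeSet (C j))).1 (hle hX)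
        (Finsupp.single x 1) (by simp)
      by_cases h : x = y
      · rwa [h]
      · exact absurd (Finsupp.single_eq_of_ne (Ne.symm h)) hxy
    simp only [Finset.eq_of_subset_of_card_le hsub (hanti i j hij.le)]

/-- Finiteness of the set of minimal generators is Dickson's lemma. -/
theorem finite_minGens [Finite σ] (I : Ideal (MvPolynomial σ K)) : (minGens I).Finite :=
  WellQuasiOrderedLE.finite_of_isAntichain (setOfPred_minimal_antichain _)

theorem IsMonomialIdeal.eq_monomialSpan_minGens {I : Ideal (MvPolynomial σ K)}
    (hI : IsMonomialIdeal I) : I = monomialSpan K (upperHull ∅ (minGens I)) := by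
  have hup : ∀ a ∈ minGens I, ∀ s, a ≤ s → monomial s (1 : K) ∈ I := by
    intro a ha s has
    have := I.mul_mem_left (monomial (s - a) (1 : K)) (show monomial a (1 : K) ∈ I from ha.1)
    rwa [monomial_mul, one_mul, tsub_add_cancel_of_le has] at this
  apply le_antisymm
  · obtain ⟨A, hA⟩ := hI
    nth_rw 1 [hA]
    rw [Ideal.span_le]
    rintro _ ⟨a, ha, rfl⟩
    obtain ⟨b, hba, hb⟩ := exists_minimal_le_of_wellFoundedLT
      (fun b => monomial b (1 : K) ∈ I) a (by rw [hA]; exact Ideal.subset_span ⟨a, ha, rfl⟩)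
    exact Ideal.subset_span ⟨a, Or.inr ⟨b, hb, hba⟩, rfl⟩
  · rw [monomialSpan, Ideal.span_le]
    rintro _ ⟨s, ⟨i, hi, -⟩ | ⟨a, ha, has⟩, rfl⟩
    · exact absurd hi (Finset.notMem_empty i)
    · exact hup a ha s has

end Ideals

end ForestType

theorem theorem3p4 {K : Type*} [Field K] {n : ℕ} (I : Ideal (MvPolynomial (Fin n) K))
    (hI : ForestType.IsForestType I) : ForestType.IsPrettyClean I := by
  obtain ⟨hmon, hleaf⟩ := hI
  have hfin := ForestType.finite_minGens I
  have hclean := ForestType.IsForest.layerwiseClean hfin.toFinset ∅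
    (by rw [hfin.coe_toFinset]; exact hleaf) (by simp)
  rw [hfin.coe_toFinset] at hclean
  have hsorted := hclean.heightSorted n
  rw [ForestType.codimPart_eq_self (by simp)] at hsorted
  rw [hmon.eq_monomialSpan_minGens]
  exact hsorted.isPrettyClean (ForestType.isUpperSet_upperHull _ _)
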